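/- **Setting.** Let $n\ge 1$, $1\le m\le n$ and $N>2$ be integers, let $g:\mathbb R\times\mathbb R\to\mathbb R$ be continuous, let $a_0(t),\dots,a_{n-1}(t)$ $(t=0,\dots,N-1)$ and $b_{ij}(k)$ $(1\le i,j\le n,\ 0\le k\le N)$ be real numbers with $a_0(t)\ne 0$ for all $t$. Consider the boundary value problem $$y(t+n)+a_{n-1}(t)y(t+n-1)+\cdots+a_0(t)y(t)=g(t,y(t+m-1)),\qquad t=0,\dots,N-1, \tag{1}$$ $$\sum_{k=0}^{N}\sum_{j=1}^n b_{ij}(k)\,y(j+k-1)=0,\qquad i=1,\dots,n. \tag{2}$$ Put $B_k=(b_{ij}(k))_{i,j}$ and assume that the boundary conditions are independent, i.e. the matrix $[B_0,\dots,B_N]$ has full row rank. Let $A(t)$ be the $n\times n$ companion matrix with ones on the superdiagonal, last row $(-a_0(t),\dots,-a_{n-1}(t))$ and zeros elsewhere, and let $\Phi(0)=I$, $\Phi(t)=A(t-1)\cdots A(0)$. Let $|\cdot|$ be the Euclidean norm on $\mathbb R^n$ and let $[v]_k$ denote the $k$-th coordinate of $v\in\mathbb R^n$. Let $$X=\Big\{\phi:\{0,\dots,N\}\to\mathbb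 R^n \;:\; \sum_{i=0}^N B_i\phi(i)=0\Big\},\qquad Z=\{\phi:\{0,\dots,N-1\}\to\mathbb R^n\},$$ both with the supremum norm, and let $\mathcal L:X\to Z$, $(\mathcal Lx)(t)=x(t+1)-A(t)x(t)$. Assume that $\operatorname{Ker}\mathcal L$ is 1-dimensional. Then $\operatorname{Ker}\big(\sum_{i=0}^N B_i\Phi(i)\big)$ and $\operatorname{Ker}\big((\sum_{i=0}^N B_i\Phi(i))^T\big)$ are 1-dimensional; let $u$ and $w$, respectively, be basis vectors of them, and set $$S(t)=\Phi(t)u,\qquad \Psi^T(t)=\sum_{i=t+1}^N w^TB_i\Phi(i)\Phi^{-1}(t+1)\quad (0\le t\le N-1).$$ Let $V$ be the orthogonal projection of $\mathbb R^n$ onto $\operatorname{Ker}\big(\sum_{i=0}^N B_i\Phi(i)\big)$, and let $P:X\to X$, $(Px)(t)=\Phi(t)Vx(0)$, and $Q:Z\to Z$, $$(Qh)(t)=\Psi(t)\Big(\sum_{j=0}^{N-1}|\Psi(j)|^2\Big)^{-1}\sum_{i=0}^{N-1}\Psi^T(i)h(i).$$ Then $P$ is a projection onto $\operatorname{Ker}\mathcal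 L$ and $I-Q$ is a projection onto $\operatorname{Im}\mathcal L$; let $M_p=(\mathcal L|_{\operatorname{Ker}P})^{-1}:\operatorname{Im}\mathcal L\to\operatorname{Ker}P$, and let $A=\|M_p(I-Q)\|$ be the operator norm of $M_p(I-Q):Z\to X$. Define the subsets of $\{0,\dots,N-1\}$ $$\begin{aligned}\mathcal O_{++}&=\{t:[\Psi(t)]_n>0,\ [S(t)]_m>0\}, & \mathcal O_{+-}&=\{t:[\Psi(t)]_n>0,\ [S(t)]_m<0\},\\ \mathcal O_{-+}&=\{t:[\Psi(t)]_n<0,\ [S(t)]_m>0\}, & \mathcal O_{--}&=\{t:[\Psi(t)]_n<0,\ [S(t)]_m<0\},\end{aligned}$$ $$\mathcal O_0=\{t:[\Psi(t)]_n\ne0,\ [S(t)]_m=0\},\qquad \mathcal O=\mathcal O_{++}\cup\mathcal O_{+-}\cup\mathcal O_{-+}\cup\mathcal O_{--}.$$ Assume that $\mathcal O$ is nonempty, and put $$s_{\max}=\max_{0\le t\le N-1}|[S(t)]_m|,\qquad s_{\min}=\min_{t\in\mathcal O}|[S(t)]_m|,\qquad \|g\|_r=\sup_{0\le t\le N-1,\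 x\in[-r,r]}|g(t,x)|.$$ **Theorem.** Suppose that the following conditions hold. * **C1.** $\mathcal O_0$ is empty. * **C2.** There are real numbers $0<c<d$ and functions $W_1,U_1,W_2,U_2,w_1,u_1,w_2,u_2:\{0,\dots,N-1\}\to\mathbb R$ such that * for $t\in\mathcal O_{++}$: $W_1(t)<g(t,x)$ for $x\in[c,d]$, and $g(t,x)<U_1(t)$ for $x\in[-d,-c]$; * for $t\in\mathcal O_{+-}$: $g(t,x)<u_1(t)$ for $x\in[c,d]$, and $w_1(t)<g(t,x)$ for $x\in[-d,-c]$; * for $t\in\mathcal O_{-+}$: $g(t,x)<W_2(t)$ for $x\in[c,d]$, and $U_2(t)<g(t,x)$ for $x\in[-d,-c]$; * for $t\in\mathcal O_{--}$: $u_2(t)<g(t,x)$ for $x\in[c,d]$, and $g(t,x)<w_2(t)$ for $x\in[-d,-c]$. * **C3.** For these $c,d$, $\displaystyle d>\frac{c\,s_{\max}+A\|g\|_d\,(s_{\max}+s_{\min})}{s_{\min}}$. * **C4.** $J_2\le 0\le J_1$, where $J_1=\sum_{i=0}^{N-1}[\Psi(i)]_nK_1(i)$, $J_2=\sum_{i=0}^{N-1}[\Psi(i)]_nK_2(i)$;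 here $K_1$ equals $W_1,w_1,W_2,w_2$ and $K_2$ equals $U_1,u_1,U_2,u_2$ on $\mathcal O_{++},\mathcal O_{+-},\mathcal O_{-+},\mathcal O_{--}$, respectively. (Outside $\mathcal O$ the values of $K_1,K_2$ are irrelevant, since there $[\Psi(i)]_n=0$ by C1.) Then the boundary value problem (1)–(2) has a solution $y:\{0,\dots,N+n-1\}\to\mathbb R$. -/

import Mathlib

open scoped BigOperators

noncomputable section

namespace MultipointBVP

/-- Euclidean space `ℝⁿ`, with the Euclidean norm. -/
abbrev E (n : ℕ) : Type := EuclideanSpace ℝ (Fin n)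

/-- The index of the `n`-th (last) coordinate of a vector in `ℝⁿ`, `n ≥ 1`. -/
def last (n : ℕ) [NeZero n] : Fin n := ⟨n - 1, Nat.sub_one_lt (NeZero.ne n)⟩

/-- The linear part of the boundary value problem
`y(t+n) + a_{n-1}(t) y(t+n-1) + ⋯ + a_0(t) y(t) = g(t, y(t+m-1))`, `t = 0, …, N-1`,
`∑_k ∑_j b_{ij}(k) y(j+k-1) = 0`, `i = 1, …, n`.
All matrix and vector indices are shifted to start at `0`; only the values `a t` with `t < N`
and `b k` with `k ≤ N` are ever used. -/
structure LinearBVP (n N : ℕ) [NeZero n] where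
  /-- `a t j` is the coefficient `a_j(t)`. -/
  a : ℕ → Fin n → ℝ
  /-- `b k` is the matrix `B_k`. -/
  b : ℕ → Matrix (Fin n) (Fin n) ℝ
  a_zero_ne : ∀ t < N, a t 0 ≠ 0
  /-- Independence of the boundary conditions: the rows of `[B_0, …, B_N]` are independent. -/
  indep : LinearIndependent ℝ
    (fun (i : Fin n) (p : Fin (N + 1) × Fin n) => b (p.1 : ℕ) i p.2)

/-- The nonzero vector `v` is a basis of the (hence one-dimensional) subspace `K`. -/
def IsBasisVector {V : Type*} [AddCommGroup V] [Module ℝ V] (v : V) (K : Submodule ℝ V) : Prop :=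
  v ≠ 0 ∧ Submodule.span ℝ {v} = K

/-- `‖g‖_r`, the supremum of `|g(t, x)|` over `t ∈ {0, …, N-1}` and `x ∈ [-r, r]`. -/
def gNorm (N : ℕ) (g : ℝ × ℝ → ℝ) (r : ℝ) : ℝ :=
  sSup {s : ℝ | ∃ t : Fin N, ∃ x ∈ Set.Icc (-r) r, s = |g (((t : ℕ) : ℝ), x)|}

namespace LinearBVP

variable {n N : ℕ} [NeZero n] (𝓑 : LinearBVP n N)

/-- `y` solves the scalar boundary value problem with nonlinearity `g(t, y(t+m))`
(`m` counted from `0`). Only the values `y 0, …, y (N+n-1)` matter. -/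
def IsSolution (g : ℝ × ℝ → ℝ) (m : Fin n) (y : ℕ → ℝ) : Prop :=
  (∀ t < N, y (t + n) + ∑ j : Fin n, 𝓑.a t j * y (t + (j : ℕ)) =
    g ((t : ℝ), y (t + (m : ℕ)))) ∧
  ∀ i : Fin n, ∑ k ∈ Finset.range (N + 1), ∑ j : Fin n, 𝓑.b k i j * y ((j : ℕ) + k) = 0

/-- The companion matrix `A(t)`. -/
def A (t : ℕ) : Matrix (Fin n) (Fin n) ℝ :=
  Matrix.of fun i j =>
    if i = last n then -𝓑.a t j else if (j : ℕ) = (i : ℕ) + 1 then 1 else 0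

/-- The fundamental matrix `Φ(t) = A(t-1) ⋯ A(0)`. -/
def Φ : ℕ → Matrix (Fin n) (Fin n) ℝ
  | 0 => 1
  | t + 1 => 𝓑.A t * Φ t

/-- The matrix `∑_{i=0}^N B_i Φ(i)`. -/
def M : Matrix (Fin n) (Fin n) ℝ := ∑ i ∈ Finset.range (N + 1), 𝓑.b i * 𝓑.Φ i

/-- `Ker (∑ B_i Φ(i))`. -/
def kerM : Submodule ℝ (E n) := LinearMap.ker (Matrix.toEuclideanLin 𝓑.M)

/-- `Ker ((∑ B_i Φ(i))ᵀ)`. -/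
def kerMT : Submodule ℝ (E n) := LinearMap.ker (Matrix.toEuclideanLin (Matrix.transpose 𝓑.M))

/-- The linear map `φ ↦ ∑_{i=0}^N B_i φ(i)`. -/
def boundary : (Fin (N + 1) → E n) →ₗ[ℝ] E n :=
  ∑ i : Fin (N + 1), (Matrix.toEuclideanLin (𝓑.b (i : ℕ))) ∘ₗ LinearMap.proj i

/-- `X`: the functions `{0, …, N} → ℝⁿ` that satisfy the boundary conditions, with the
supremum norm. -/
def X : Submodule ℝ (Fin (N + 1) → E n) := LinearMap.ker 𝓑.boundary

/-- `Z`: the functions `{0, …, N-1} → ℝⁿ`, with the supremum norm. -/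
abbrev Z (_ : LinearBVP n N) : Type := Fin N → E n

/-- `(𝓛x)(t) = x(t+1) - A(t) x(t)`. -/
def L : 𝓑.X →ₗ[ℝ] 𝓑.Z :=
  (LinearMap.pi fun t : Fin N =>
    (LinearMap.proj t.succ : (Fin (N + 1) → E n) →ₗ[ℝ] E n) -
      Matrix.toEuclideanLin (𝓑.A (t : ℕ)) ∘ₗ
        (LinearMap.proj t.castSucc : (Fin (N + 1) → E n) →ₗ[ℝ] E n)) ∘ₗ 𝓑.X.subtype

/-- `S(t) = Φ(t) u`. -/
def S (u : E n) (t : ℕ) : E n := Matrix.toEuclideanLin (𝓑.Φ t) u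

/-- `Ψᵀ(t) = ∑_{i=t+1}^N wᵀ B_i Φ(i) Φ⁻¹(t+1)`. -/
def Ψ (w : E n) (t : ℕ) : E n :=
  WithLp.toLp 2 (∑ i ∈ Finset.Icc (t + 1) N,
    Matrix.vecMul (WithLp.ofLp w) (𝓑.b i * 𝓑.Φ i * (𝓑.Φ (t + 1))⁻¹))

/-- `Q h (t) = Ψ(t) (∑_j |Ψ(j)|²)⁻¹ ∑_i Ψᵀ(i) h(i)`. -/
def Q (w : E n) : 𝓑.Z →ₗ[ℝ] 𝓑.Z :=
  LinearMap.pi fun t : Fin N =>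
    (∑ i : Fin N, (innerSL ℝ (𝓑.Ψ w (i : ℕ))).toLinearMap ∘ₗ
      (LinearMap.proj i : 𝓑.Z →ₗ[ℝ] E n)).smulRight
      ((∑ j : Fin N, ‖𝓑.Ψ w (j : ℕ)‖ ^ 2)⁻¹ • 𝓑.Ψ w (t : ℕ))

lemma L_apply (x : 𝓑.X) (t : Fin N) :
    𝓑.L x t = x.1 t.succ - Matrix.toEuclideanLin (𝓑.A (t : ℕ)) (x.1 t.castSucc) := rfl

lemma boundary_apply (φ : Fin (N + 1) → E n) :
    𝓑.boundary φ = ∑ i : Fin (N + 1), Matrix.toEuclideanLin (𝓑.b (i : ℕ)) (φ i) := by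
  simp [boundary]

lemma mem_X {φ : Fin (N + 1) → E n} : φ ∈ 𝓑.X ↔
    ∑ i : Fin (N + 1), Matrix.toEuclideanLin (𝓑.b (i : ℕ)) (φ i) = 0 := by
  rw [← boundary_apply]
  exact LinearMap.mem_ker

lemma M_apply (v : E n) : Matrix.toEuclideanLin 𝓑.M v =
    ∑ i : Fin (N + 1), Matrix.toEuclideanLin (𝓑.b (i : ℕ))
      (Matrix.toEuclideanLin (𝓑.Φ (i : ℕ)) v) := by
  rw [M, ← Fin.sum_univ_eq_sum_range (fun i => 𝓑.b i * 𝓑.Φ i), map_sum]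
  simp [Matrix.toLpLin_mul_same]

lemma Q_apply (w : E n) (h : 𝓑.Z) (t : Fin N) :
    𝓑.Q w h t = (∑ i : Fin N, inner ℝ (𝓑.Ψ w (i : ℕ)) (h i)) •
      ((∑ j : Fin N, ‖𝓑.Ψ w (j : ℕ)‖ ^ 2)⁻¹ • 𝓑.Ψ w (t : ℕ)) := by
  simp [Q, LinearMap.sum_apply]

/-- `V` is the orthogonal projection onto `Ker (∑ B_i Φ(i))`; `(Px)(t) = Φ(t) V x(0)`. -/
def P : 𝓑.X →ₗ[ℝ] 𝓑.X :=
  LinearMap.codRestrict 𝓑.X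
    ((LinearMap.pi fun t : Fin (N + 1) =>
      Matrix.toEuclideanLin (𝓑.Φ (t : ℕ)) ∘ₗ 𝓑.kerM.starProjection.toLinearMap ∘ₗ
        LinearMap.proj 0) ∘ₗ 𝓑.X.subtype)
    (fun x => by
      have h : 𝓑.kerM.starProjection (x.1 0) ∈ 𝓑.kerM := Submodule.starProjection_apply_mem _ _
      rw [kerM, LinearMap.mem_ker, M_apply] at h
      rw [mem_X]
      exact h)

lemma P_apply (x : 𝓑.X) (t : Fin (N + 1)) :
    (𝓑.P x).1 t = Matrix.toEuclideanLin (𝓑.Φ (t : ℕ)) (𝓑.kerM.starProjection (x.1 0)) := rfl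

lemma L_P (x : 𝓑.X) : 𝓑.L (𝓑.P x) = 0 := by
  funext t
  rw [L_apply, P_apply, P_apply]
  simp [Φ, Matrix.toLpLin_mul_same]

lemma eq_Φ_of_L_eq_zero {x : 𝓑.X} (hx : 𝓑.L x = 0) (t : Fin (N + 1)) :
    x.1 t = Matrix.toEuclideanLin (𝓑.Φ (t : ℕ)) (x.1 0) := by
  induction t using Fin.induction with
  | zero => simp [Φ]
  | succ t ih =>
    have := congrFun hx t
    rw [L_apply, Pi.zero_apply, sub_eq_zero] at this
    rw [this, ih]
    simp [Φ, Matrix.toLpLin_mul_same]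

lemma P_of_L_eq_zero {x : 𝓑.X} (hx : 𝓑.L x = 0) : 𝓑.P x = x := by
  have h0 : x.1 0 ∈ 𝓑.kerM := by
    rw [kerM, LinearMap.mem_ker, M_apply]
    have hX := x.2
    rw [mem_X] at hX
    rw [← hX]
    exact Finset.sum_congr rfl fun i _ => by rw [← 𝓑.eq_Φ_of_L_eq_zero hx i]
  apply Subtype.ext
  funext t
  rw [P_apply, Submodule.starProjection_eq_self_iff.mpr h0, ← 𝓑.eq_Φ_of_L_eq_zero hx t]

/-- `𝓛` restricted to `Ker P`, as a map onto `Im 𝓛`. -/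
def LKerP : LinearMap.ker 𝓑.P →ₗ[ℝ] LinearMap.range 𝓑.L :=
  𝓑.L.rangeRestrict ∘ₗ (LinearMap.ker 𝓑.P).subtype

lemma LKerP_bijective : Function.Bijective 𝓑.LKerP := by
  constructor
  · intro x y hxy
    have h1 : 𝓑.L (x.1 - y.1) = 0 := by
      rw [map_sub, sub_eq_zero]
      exact congrArg Subtype.val hxy
    have h2 : 𝓑.P (x.1 - y.1) = 0 := by
      rw [map_sub, LinearMap.mem_ker.mp x.2, LinearMap.mem_ker.mp y.2, sub_zero]
    rw [𝓑.P_of_L_eq_zero h1] at h2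
    exact Subtype.ext (sub_eq_zero.mp h2)
  · rintro ⟨z, x, rfl⟩
    refine ⟨⟨x - 𝓑.P x, ?_⟩, ?_⟩
    · rw [LinearMap.mem_ker, map_sub, 𝓑.P_of_L_eq_zero (𝓑.L_P x), sub_self]
    · apply Subtype.ext
      change 𝓑.L (x - 𝓑.P x) = 𝓑.L x
      rw [map_sub, L_P, sub_zero]

/-- `M_p`, the inverse of `𝓛` restricted to `Ker P`. -/
def Mp : LinearMap.range 𝓑.L →ₗ[ℝ] LinearMap.ker 𝓑.P :=
  (LinearEquiv.ofBijective 𝓑.LKerP 𝓑.LKerP_bijective).symm.toLinearMap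

lemma A_isUnit {t : ℕ} (ht : t < N) : IsUnit (𝓑.A t) := by
  rw [← Matrix.mulVec_injective_iff_isUnit]
  have key : ∀ x : Fin n → ℝ, Matrix.mulVec (𝓑.A t) x = 0 → x = 0 := by
    intro x hx
    have hs : ∀ j : Fin n, j ≠ 0 → x j = 0 := by
      intro j hj
      have hj0 : (j : ℕ) ≠ 0 := fun h => hj (Fin.ext (by simpa using h))
      have hlt : (j : ℕ) - 1 < n := by omega
      have h := congrFun hx ⟨(j : ℕ) - 1, hlt⟩
      have hne : (⟨(j : ℕ) - 1, hlt⟩ : Fin n) ≠ last n := by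
        intro h'
        have := congrArg Fin.val h'
        simp only [last] at this
        omega
      simp only [Matrix.mulVec, dotProduct, A, Matrix.of_apply, if_neg hne, Pi.zero_apply] at h
      rw [Finset.sum_eq_single j] at h
      · rw [if_pos (show (j : ℕ) = (j : ℕ) - 1 + 1 by omega)] at h
        simpa using h
      · intro k _ hk
        rw [if_neg, zero_mul]
        intro h'
        exact hk (Fin.ext (by omega))
      · simp
    have h := congrFun hx (last n)
    simp only [Matrix.mulVec, dotProduct, A, Matrix.of_apply, if_true, Pi.zero_apply] at h
    rw [Finset.sum_eq_single 0 (fun k _ hk => by rw [hs k hk, mul_zero]) (by simp)] at h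
    have h0 : x 0 = 0 := by
      rcases mul_eq_zero.mp h with h | h
      · exact absurd (neg_eq_zero.mp h) (𝓑.a_zero_ne t ht)
      · exact h
    funext j
    by_cases hj : j = 0
    · rw [hj, h0]; rfl
    · exact hs j hj
  intro x y hxy
  have := key (x - y) (by rw [Matrix.mulVec_sub]; exact sub_eq_zero.mpr hxy)
  exact sub_eq_zero.mp this

lemma Φ_isUnit {t : ℕ} (ht : t ≤ N) : IsUnit (𝓑.Φ t) := by
  induction t with
  | zero => exact isUnit_one
  | succ t ih => exact (𝓑.A_isUnit (by omega)).mul (ih (by omega))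

/-- Nondegeneracy of `Ψ`, from the independence of the boundary conditions. -/
lemma Ψ_ne_zero {w : E n} (hw : IsBasisVector w 𝓑.kerMT) : ∃ t : Fin N, 𝓑.Ψ w (t : ℕ) ≠ 0 := by
  by_contra hcon
  push Not at hcon
  set r : ℕ → Fin n → ℝ := fun i => Matrix.vecMul (WithLp.ofLp w) (𝓑.b i * 𝓑.Φ i) with hr
  have hsum : ∀ t < N, ∑ i ∈ Finset.Icc (t + 1) N, r i = 0 := by
    intro t ht
    have h := congrArg WithLp.ofLp (hcon ⟨t, ht⟩)
    simp only [Ψ, WithLp.ofLp_zero] at h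
    have h2 := congrArg (fun v => Matrix.vecMul v (𝓑.Φ (t + 1))) h
    simp only [Matrix.zero_vecMul, Matrix.sum_vecMul, Matrix.vecMul_vecMul] at h2
    rw [← h2]
    refine Finset.sum_congr rfl fun i _ => ?_
    rw [Matrix.mul_assoc (𝓑.b i * 𝓑.Φ i), Matrix.nonsing_inv_mul _
      ((Matrix.isUnit_iff_isUnit_det _).mp (𝓑.Φ_isUnit ht)), Matrix.mul_one]
  have hall : ∑ i ∈ Finset.Icc 0 N, r i = 0 := by
    have hk : w ∈ 𝓑.kerMT := hw.2 ▸ Submodule.mem_span_singleton_self w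
    have h := congrArg WithLp.ofLp (LinearMap.mem_ker.mp hk)
    rw [Matrix.ofLp_toLpLin, Matrix.toLin'_apply, Matrix.mulVec_transpose, M,
      Matrix.vecMul_sum] at h
    have hI : Finset.Icc 0 N = Finset.range (N + 1) := by ext; simp
    rw [hI]
    exact h
  have hge : ∀ t ≤ N, ∑ i ∈ Finset.Icc t N, r i = 0 := by
    intro t ht
    rcases t with _ | t
    · exact hall
    · exact hsum t (by omega)
  have hri : ∀ t ≤ N, r t = 0 := by
    intro t ht
    have h := hge t ht
    rw [← Finset.insert_Icc_add_one_left_eq_Icc ht, Finset.sum_insert (by simp)] at h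
    rcases ht.lt_or_eq with hlt | rfl
    · rwa [hge (t + 1) hlt, add_zero] at h
    · simpa using h
  have hb : ∀ t ≤ N, Matrix.vecMul (WithLp.ofLp w) (𝓑.b t) = 0 := by
    intro t ht
    have h := hri t ht
    have h2 := congrArg (fun v => Matrix.vecMul v (𝓑.Φ t)⁻¹) h
    simp only [hr, Matrix.zero_vecMul, Matrix.vecMul_vecMul] at h2
    rwa [Matrix.mul_assoc, Matrix.mul_nonsing_inv _
      ((Matrix.isUnit_iff_isUnit_det _).mp (𝓑.Φ_isUnit ht)), Matrix.mul_one] at h2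
  have hw0 := Fintype.linearIndependent_iff.mp 𝓑.indep (WithLp.ofLp w) (by
    funext p
    have h := congrFun (hb (p.1 : ℕ) (by omega)) p.2
    simpa [Matrix.vecMul, dotProduct, Finset.sum_apply] using h)
  exact hw.1 (by ext i; exact hw0 i)

/-- The element of `ℝⁿ` in the characterization of `Im 𝓛`, and its pairing with `w`. -/
lemma inner_sum_eq (w : E n) (h : 𝓑.Z) :
    inner ℝ w (∑ k : Fin (N + 1), Matrix.toEuclideanLin (𝓑.b (k : ℕ))
      (Matrix.toEuclideanLin (𝓑.Φ (k : ℕ)) (∑ i : Fin N, if (i : ℕ) < (k : ℕ) then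
        Matrix.toEuclideanLin (𝓑.Φ ((i : ℕ) + 1))⁻¹ (h i) else 0))) =
    ∑ i : Fin N, inner ℝ (𝓑.Ψ w (i : ℕ)) (h i) := by
  have hΨ : ∀ i : Fin N, inner ℝ (𝓑.Ψ w (i : ℕ)) (h i) =
      ∑ k : Fin (N + 1), if (i : ℕ) < (k : ℕ) then
        inner ℝ w (Matrix.toEuclideanLin (𝓑.b (k : ℕ))
          (Matrix.toEuclideanLin (𝓑.Φ (k : ℕ))
            (Matrix.toEuclideanLin (𝓑.Φ ((i : ℕ) + 1))⁻¹ (h i)))) else 0 := by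
    intro i
    rw [Fin.sum_univ_eq_sum_range (fun k => if (i : ℕ) < k then
        inner ℝ w (Matrix.toEuclideanLin (𝓑.b k)
          (Matrix.toEuclideanLin (𝓑.Φ k)
            (Matrix.toEuclideanLin (𝓑.Φ ((i : ℕ) + 1))⁻¹ (h i)))) else 0) (N + 1),
      ← Finset.sum_filter]
    have hI : (Finset.range (N + 1)).filter (fun k => (i : ℕ) < k) =
        Finset.Icc ((i : ℕ) + 1) N := by ext k; simp; omega
    rw [hI]
    simp only [Ψ, EuclideanSpace.inner_eq_star_dotProduct, star_trivial,
      Matrix.ofLp_toLpLin, Matrix.toLin'_apply, Matrix.mulVec_mulVec, dotProduct_sum]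
    refine Finset.sum_congr rfl fun k _ => ?_
    rw [dotProduct_comm, ← Matrix.dotProduct_mulVec, dotProduct_comm, Matrix.mul_assoc]
  simp only [hΨ]
  rw [inner_sum, Finset.sum_comm]
  refine Finset.sum_congr rfl fun k _ => ?_
  rw [map_sum, map_sum, inner_sum]
  refine Finset.sum_congr rfl fun i _ => ?_
  split_ifs <;> simp

lemma mem_range_L {w : E n} (hw : IsBasisVector w 𝓑.kerMT) (h : 𝓑.Z)
    (hh : ∑ i : Fin N, inner ℝ (𝓑.Ψ w (i : ℕ)) (h i) = 0) : h ∈ LinearMap.range 𝓑.L := by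
  set s : ℕ → E n := fun k => ∑ i : Fin N, if (i : ℕ) < k then
        Matrix.toEuclideanLin (𝓑.Φ ((i : ℕ) + 1))⁻¹ (h i) else 0 with hs
  set q : E n := ∑ k : Fin (N + 1), Matrix.toEuclideanLin (𝓑.b (k : ℕ))
      (Matrix.toEuclideanLin (𝓑.Φ (k : ℕ)) (s k)) with hq
  have hwq : inner ℝ w q = 0 := (𝓑.inner_sum_eq w h).trans hh
  have hqr : -q ∈ LinearMap.range (Matrix.toEuclideanLin 𝓑.M) := by
    rw [← Submodule.orthogonal_orthogonal (LinearMap.range (Matrix.toEuclideanLin 𝓑.M)),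
      LinearMap.orthogonal_range, ← Matrix.toEuclideanLin_conjTranspose_eq_adjoint,
      Matrix.conjTranspose_eq_transpose_of_trivial]
    change -q ∈ (𝓑.kerMT)ᗮ
    rw [← hw.2, Submodule.mem_orthogonal_singleton_iff_inner_right, inner_neg_right, hwq, neg_zero]
  obtain ⟨x0, hx0⟩ := hqr
  refine ⟨⟨fun t => Matrix.toEuclideanLin (𝓑.Φ (t : ℕ)) (x0 + s t), ?_⟩, ?_⟩
  · rw [mem_X]
    simp only [map_add, Finset.sum_add_distrib]
    rw [← M_apply, hx0, ← hq, neg_add_cancel]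
  · funext t
    have hst : s ((t : ℕ) + 1) = s t + Matrix.toEuclideanLin (𝓑.Φ ((t : ℕ) + 1))⁻¹ (h t) := by
      have : Matrix.toEuclideanLin (𝓑.Φ ((t : ℕ) + 1))⁻¹ (h t) =
          ∑ i : Fin N, if i = t then
            Matrix.toEuclideanLin (𝓑.Φ ((i : ℕ) + 1))⁻¹ (h i) else 0 := by simp
      rw [this]
      simp only [hs]
      rw [← Finset.sum_add_distrib]
      refine Finset.sum_congr rfl fun i _ => ?_
      by_cases h1 : i = t
      · subst h1; simp
      · have h1' : (i : ℕ) ≠ (t : ℕ) := fun h' => h1 (Fin.ext h')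
        by_cases h2 : (i : ℕ) < (t : ℕ)
        · simp [h1, h2, Nat.lt_succ_of_lt h2]
        · simp [h1, h2, show ¬ (i : ℕ) < (t : ℕ) + 1 by omega]
    have hinv : ∀ v : E n, Matrix.toEuclideanLin (𝓑.Φ ((t : ℕ) + 1))
        (Matrix.toEuclideanLin (𝓑.Φ ((t : ℕ) + 1))⁻¹ v) = v := by
      intro v
      rw [← LinearMap.comp_apply, ← Matrix.toLpLin_mul_same, Matrix.mul_nonsing_inv _
        ((Matrix.isUnit_iff_isUnit_det _).mp (𝓑.Φ_isUnit t.2)), Matrix.toLpLin_one]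
      rfl
    have hΦ : ∀ v : E n, Matrix.toEuclideanLin (𝓑.Φ ((t : ℕ) + 1)) v =
        Matrix.toEuclideanLin (𝓑.A t) (Matrix.toEuclideanLin (𝓑.Φ t) v) := by
      intro v
      rw [Φ, Matrix.toLpLin_mul_same]
      rfl
    rw [L_apply]
    simp only [Fin.val_succ, Fin.val_castSucc]
    rw [hst, ← add_assoc, map_add _ (x0 + s t), hinv, hΦ]
    abel

lemma sub_Q_mem_range {w : E n} (hw : IsBasisVector w 𝓑.kerMT) (h : 𝓑.Z) :
    (LinearMap.id - 𝓑.Q w : 𝓑.Z →ₗ[ℝ] 𝓑.Z) h ∈ LinearMap.range 𝓑.L := by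
  apply 𝓑.mem_range_L hw
  have hne : ∑ j : Fin N, ‖𝓑.Ψ w (j : ℕ)‖ ^ 2 ≠ 0 := by
    obtain ⟨t, ht⟩ := 𝓑.Ψ_ne_zero hw
    have h1 : 0 < ‖𝓑.Ψ w (t : ℕ)‖ ^ 2 := by positivity
    exact (Finset.sum_pos' (fun i _ => by positivity) ⟨t, Finset.mem_univ _, h1⟩).ne'
  simp only [LinearMap.sub_apply, LinearMap.id_apply, Pi.sub_apply, Q_apply, inner_sub_right,
    inner_smul_right, real_inner_self_eq_norm_sq, Finset.sum_sub_distrib]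
  rw [← Finset.mul_sum, ← Finset.mul_sum, inv_mul_cancel₀ hne, mul_one, sub_self]

/-- `M_p (I - Q) : Z → X`, with `I - Q` viewed as a map into `Im 𝓛`. -/
def MpIQ {w : E n} (hw : IsBasisVector w 𝓑.kerMT) : 𝓑.Z →ₗ[ℝ] 𝓑.X :=
  (LinearMap.ker 𝓑.P).subtype ∘ₗ 𝓑.Mp ∘ₗ
    LinearMap.codRestrict (LinearMap.range 𝓑.L) (LinearMap.id - 𝓑.Q w) (𝓑.sub_Q_mem_range hw)

/-- The operator norm of `M_p (I - Q)`, for the supremum norms on `Z` and `X`. -/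
def opNormA {w : E n} (hw : IsBasisVector w 𝓑.kerMT) : ℝ :=
  ‖LinearMap.toContinuousLinearMap (𝓑.MpIQ hw)‖

/-- `[Ψ(t)]_n`. -/
def ψ (w : E n) (t : Fin N) : ℝ := 𝓑.Ψ w (t : ℕ) (last n)

/-- `[S(t)]_m` (`m` counted from `0`). -/
def σ (u : E n) (m : Fin n) (t : Fin N) : ℝ := 𝓑.S u (t : ℕ) m

variable (u w : E n) (m : Fin n)

def Opp : Set (Fin N) := {t | 0 < 𝓑.ψ w t ∧ 0 < 𝓑.σ u m t}

def Opm : Set (Fin N) := {t | 0 < 𝓑.ψ w t ∧ 𝓑.σ u m t < 0}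

def Omp : Set (Fin N) := {t | 𝓑.ψ w t < 0 ∧ 0 < 𝓑.σ u m t}

def Omm : Set (Fin N) := {t | 𝓑.ψ w t < 0 ∧ 𝓑.σ u m t < 0}

def Ozero : Set (Fin N) := {t | 𝓑.ψ w t ≠ 0 ∧ 𝓑.σ u m t = 0}

/-- `𝓞 = 𝓞₊₊ ∪ 𝓞₊₋ ∪ 𝓞₋₊ ∪ 𝓞₋₋`. -/
def O : Set (Fin N) := 𝓑.Opp u w m ∪ 𝓑.Opm u w m ∪ 𝓑.Omp u w m ∪ 𝓑.Omm u w m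

/-- `s_max`, the maximum of `|[S(t)]_m|` over `t ∈ {0, …, N-1}`. -/
def sMax : ℝ := ⨆ t : Fin N, |𝓑.σ u m t|

/-- `s_min`, the minimum of `|[S(t)]_m|` over `𝓞` (meaningful when `𝓞` is nonempty). -/
def sMin : ℝ := ⨅ t : 𝓑.O u w m, |𝓑.σ u m t|

open Classical in
/-- The function that is `f₁, f₂, f₃, f₄` on `𝓞₊₊, 𝓞₊₋, 𝓞₋₊, 𝓞₋₋` respectively.
Its value elsewhere plays no role when `𝓞₀` is empty, since there `[Ψ(t)]_n = 0`. -/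
def glue (f₁ f₂ f₃ f₄ : Fin N → ℝ) (t : Fin N) : ℝ :=
  if t ∈ 𝓑.Opp u w m then f₁ t
  else if t ∈ 𝓑.Opm u w m then f₂ t
  else if t ∈ 𝓑.Omp u w m then f₃ t
  else if t ∈ 𝓑.Omm u w m then f₄ t
  else 0

end LinearBVP

end MultipointBVP

end

/-! The proof is a Lyapunov–Schmidt reduction closed by Brouwer's theorem. Writing `x = αS + v`, the
system `𝓛x = F(x)` follows from `v = M_p(I - Q)F(x)` together with the scalar equation `∑ ψ(t) g(t,
x_m(t)) = 0`, which says `QF(x) = 0`.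

Replace `g(t, ·)` by its composition with the clamp to `[-d, d]`. Then `F` is bounded by `‖g‖_d`, so
`|v| ≤ A‖g‖_d`. Put `β = (c + A‖g‖_d) / s_min`. At `α = ±β` and `t ∈ 𝓞` the term `ασ(t)` dominates
`v`, so `x_m(t)` lies in `[c, d]` or `[-d, -c]` according to the sign of `ασ(t)`. C2 and C4 then
make the scalar sum positive at `α = β` and negative at `α = -β`, whatever `v` is. Applied to `(α,
v)`, with `α` clamped to `[-β, β]`, Brouwer's theorem gives a zero (`exists_L_eq_forcing`). C3 gives
`β s_max + A‖g‖_d < d`, so the truncation is inactive at the solution.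

Brouwer's theorem itself is derived from `no_retraction`, the Milnor–Rogers volume argument. -/

namespace Brouwer

open Set Metric MeasureTheory Polynomial

/-! ### Determinants along the line `1 + tA`. -/

section Determinant

variable {E : Type*} [NormedAddCommGroup E] [NormedSpace ℝ E] [FiniteDimensional ℝ E]

/-- `det (1 + t A)` is a polynomial in `t` of degree at most the dimension. -/
lemma exists_polynomial_det (A : E →L[ℝ] E) : ∃ p : ℝ[X],
    p.natDegree ≤ Module.finrank ℝ E ∧ ∀ t : ℝ, p.eval t = (1 + t • A).det := by
  let b := Module.finBasis ℝ E
  let M := LinearMap.toMatrix b b (A : E →ₗ[ℝ] E)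
  refine ⟨Matrix.det ((X : ℝ[X]) • M.map C + (1 : Matrix _ _ ℝ).map C), ?_, fun t => ?_⟩
  · simpa using natDegree_det_X_add_C_le M 1
  · rw [ContinuousLinearMap.det, ← LinearMap.det_toMatrix b, ← coe_evalRingHom,
      RingHom.map_det]
    congr 1
    have h : LinearMap.toMatrix b b ((1 + t • A : E →L[ℝ] E) : E →ₗ[ℝ] E) = 1 + t • M := by
      have : ((1 + t • A : E →L[ℝ] E) : E →ₗ[ℝ] E) = LinearMap.id + t • (A : E →ₗ[ℝ] E) := rfl
      rw [this, map_add, map_smul, LinearMap.toMatrix_id]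
    rw [h]
    ext i j
    by_cases hij : i = j
    · subst hij
      simp [add_comm, mul_comm t]
    · simp [hij, mul_comm t]

/-- Extrapolation of `det (1 + t A)` to `t = 1` from prescribed nodes, uniformly in `A`. -/
lemma exists_weights_det (v : ℕ → ℝ) (hv : Function.Injective v) : ∃ k : ℕ → ℝ,
    (∑ i ∈ Finset.range (Module.finrank ℝ E + 1), k i = 1) ∧
    ∀ A : E →L[ℝ] E, (1 + A).det =
      ∑ i ∈ Finset.range (Module.finrank ℝ E + 1), k i * (1 + v i • A).det := by
  set s := Finset.range (Module.finrank ℝ E + 1) with hs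
  have key : ∀ p : ℝ[X], p.natDegree ≤ Module.finrank ℝ E →
      p.eval 1 = ∑ i ∈ s, (Lagrange.basis s v i).eval 1 * p.eval (v i) := by
    intro p hp
    have hdeg : p.degree < s.card := by
      rw [hs, Finset.card_range]
      exact lt_of_le_of_lt degree_le_natDegree (by exact_mod_cast Nat.lt_succ_of_le hp)
    conv_lhs => rw [Lagrange.eq_interpolate (s := s) hv.injOn hdeg]
    simp [Lagrange.interpolate_apply, eval_finsetSum, mul_comm]
  refine ⟨fun i => (Lagrange.basis s v i).eval 1, ?_, fun A => ?_⟩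
  -- The weights sum to one because extrapolation is exact on the constant polynomial `1`.
  · simpa using (key 1 (by simp)).symm
  · obtain ⟨p, hp, hpe⟩ := exists_polynomial_det A
    have := key p hp
    simpa [hpe] using this

/-- Every operator on the segment `1 + sB`, `0 ≤ s ≤ 1`, is invertible by the Neumann series, so the
determinant cannot change sign from its value `1` at `s = 0`. -/
lemma det_one_add_pos {B : E →L[ℝ] E} (hB : ‖B‖ < 1) : 0 < (1 + B).det := by
  have hne : ∀ s ∈ Icc (0 : ℝ) 1, (1 + s • B).det ≠ 0 := by
    intro s hs
    have hn : ‖-(s • B)‖ < 1 := by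
      rw [norm_neg, norm_smul, Real.norm_of_nonneg hs.1]
      nlinarith [norm_nonneg B, hs.2]
    have hu := isUnit_one_sub_of_norm_lt_one hn
    rw [sub_neg_eq_add] at hu
    obtain ⟨U, hU⟩ := hu
    have h1 : (1 + s • B).det * (U⁻¹ : (E →L[ℝ] E)ˣ).1.det = 1 := by
      rw [← hU]
      have : ((U.1 * (U⁻¹).1 : E →L[ℝ] E)).det = 1 := by
        rw [Units.mul_inv]; exact LinearMap.det_id
      rw [← this]
      exact (LinearMap.det_comp _ _).symm
    exact left_ne_zero_of_mul_eq_one h1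
  have hcont : Continuous fun s : ℝ => (1 + s • B).det :=
    ContinuousLinearMap.continuous_det.comp (by fun_prop)
  have h0 : (1 + (0 : ℝ) • B).det = 1 := by
    rw [zero_smul, add_zero]; exact LinearMap.det_id
  by_contra hneg
  push Not at hneg
  obtain ⟨s, hs, hs0⟩ := intermediate_value_Icc' (zero_le_one' ℝ) hcont.continuousOn
    (show (0 : ℝ) ∈ Icc _ _ from ⟨by simpa using hneg, by rw [h0]; exact zero_le_one⟩)
  exact hne s hs hs0

end Determinant

/-! ### Nonexistence of a `C¹` retraction of the ball onto the sphere. -/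

section Retraction

variable {E : Type*} [NormedAddCommGroup E] [InnerProductSpace ℝ E] [FiniteDimensional ℝ E]

/-- A small perturbation of the identity of the unit ball, fixing the sphere, maps the ball
bijectively to itself. -/
lemma image_ball_of_lipschitz {φ : E → E} {c : NNReal} (hc : c < 1)
    (hlip : LipschitzOnWith c (fun x => φ x - x) (closedBall 0 1))
    (hs : ∀ x ∈ sphere (0 : E) 1, φ x = x) (hb : MapsTo φ (ball 0 1) (ball 0 1)) :
    InjOn φ (ball 0 1) ∧ φ '' ball 0 1 = ball 0 1 := by
  have happ : ApproximatesLinearOn φ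
      ((ContinuousLinearEquiv.refl ℝ E : E ≃L[ℝ] E) : E →L[ℝ] E) (closedBall 0 1) c :=
    LipschitzOnWith.approximatesLinearOn hlip
  have hc' : Subsingleton E ∨
      c < ‖((ContinuousLinearEquiv.refl ℝ E).symm : E →L[ℝ] E)‖₊⁻¹ := by
    rcases subsingleton_or_nontrivial E with h | h
    · exact Or.inl h
    · right
      have : ‖((ContinuousLinearEquiv.refl ℝ E).symm : E →L[ℝ] E)‖₊ = 1 := by
        apply NNReal.eq; exact ContinuousLinearMap.norm_id
      rw [this, inv_one]; exact hc
  have hinj := happ.injOn hc'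
  refine ⟨hinj.mono ball_subset_closedBall, ?_⟩
  have hopen : IsOpen (φ '' ball 0 1) :=
    (happ.mono_set ball_subset_closedBall).open_image
      (ContinuousLinearEquiv.refl ℝ E).toNonlinearRightInverse isOpen_ball hc'
  refine Subset.antisymm hb.image_subset ?_
  -- The image is open, and relatively closed in the ball: a limit point is `φ x` with `x` in the
  -- closed ball, and `x` on the sphere would give `φ x = x` outside the open ball. Connectedness
  -- finishes.
  refine (convex_ball (0 : E) 1).isPreconnected.subset_of_closure_inter_subset hopen ?_ ?_
  · exact ⟨φ 0, hb (mem_ball_self one_pos), mem_image_of_mem _ (mem_ball_self one_pos)⟩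
  · rintro y ⟨hy, hyb⟩
    have hK : IsCompact (φ '' closedBall 0 1) :=
      (isCompact_closedBall 0 1).image_of_continuousOn happ.continuousOn
    have hy' := closure_minimal (image_mono ball_subset_closedBall) hK.isClosed hy
    obtain ⟨x, hx, rfl⟩ := hy'
    rcases (mem_closedBall.mp hx).lt_or_eq with h | h
    · exact ⟨x, h, rfl⟩
    · rw [hs x h] at hyb
      exact absurd h (mem_ball.mp hyb).ne

/-- With `g = r - id`, the Jacobian `det (1 + t Dg)` is pointwise a polynomial in `t` of bounded
degree. For small `t > 0` the map `id + t g` permutes the ball, so the integral is the volume of the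
ball, and extrapolation gives the same value at `t = 1`. There, however, the integrand is `det Dr =
0`, since `r` takes values in the sphere. -/
theorem no_retraction {r : E → E} (hr : ∀ x ∈ closedBall (0 : E) 1, ContDiffAt ℝ 1 r x)
    (hs : ∀ x ∈ sphere (0 : E) 1, r x = x) (hn : ∀ x ∈ closedBall (0 : E) 1, ‖r x‖ = 1) :
    False := by
  borelize E
  let μ : Measure E := volume
  set g : E → E := fun x => r x - x with hg
  have hgd : ∀ x ∈ closedBall (0 : E) 1, ContDiffAt ℝ 1 g x := fun x hx =>
    (hr x hx).sub contDiffAt_id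
  have hderiv : ∀ x ∈ closedBall (0 : E) 1, HasFDerivAt g (fderiv ℝ g x) x := fun x hx =>
    ((hgd x hx).differentiableAt (by norm_num)).hasFDerivAt
  have hfderiv : ContinuousOn (fderiv ℝ g) (closedBall 0 1) := fun x hx =>
    ((hgd x hx).fderiv_right (m := 0) (by norm_num)).continuousAt.continuousWithinAt
  obtain ⟨C, hC⟩ := (isCompact_closedBall (0 : E) 1).exists_bound_of_continuousOn hfderiv
  set K : NNReal := Real.toNNReal C with hK
  have hCK : ∀ x ∈ closedBall (0 : E) 1, ‖fderiv ℝ g x‖ ≤ K := fun x hx =>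
    (hC x hx).trans (Real.le_coe_toNNReal C)
  have hlip : LipschitzOnWith K g (closedBall 0 1) :=
    (convex_closedBall (0 : E) 1).lipschitzOnWith_of_nnnorm_fderiv_le
      (fun x hx => (hgd x hx).differentiableAt (by norm_num)) hCK
  -- for small `t` the integral of the Jacobian determinant is the volume of the ball
  have hvol : ∀ t : ℝ, 0 < t → t < 1 → t * K < 1 →
      ∫ x in ball (0 : E) 1, (1 + t • fderiv ℝ g x).det ∂μ = μ.real (ball 0 1) := by
    intro t ht ht1 htK
    set φ : E → E := fun x => x + t • g x with hφ
    have himg := image_ball_of_lipschitz (φ := φ) (c := t.toNNReal * K)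
      (by
        rw [← NNReal.coe_lt_coe]
        simpa [Real.coe_toNNReal t ht.le] using htK)
      (by
        have h1 : (fun x => φ x - x) = fun x => t • g x := by funext x; simp [hφ]
        rw [h1]
        rw [lipschitzOnWith_iff_norm_sub_le] at hlip ⊢
        intro x hx y hy
        rw [← smul_sub, norm_smul, Real.norm_of_nonneg ht.le, NNReal.coe_mul,
          Real.coe_toNNReal t ht.le, mul_assoc]
        exact mul_le_mul_of_nonneg_left (hlip hx hy) ht.le)
      (fun x hx => by simp [hφ, hg, hs x hx])
      (by
        intro x hx
        have h1 : φ x = (1 - t) • x + t • r x := by simp only [hφ, hg]; module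
        rw [mem_ball_zero_iff] at hx ⊢
        rw [h1]
        calc ‖(1 - t) • x + t • r x‖ ≤ ‖(1 - t) • x‖ + ‖t • r x‖ := norm_add_le _ _
          _ = (1 - t) * ‖x‖ + t := by
            rw [norm_smul, norm_smul, hn x (mem_closedBall_zero_iff.mpr hx.le),
              Real.norm_of_nonneg ht.le, Real.norm_of_nonneg (by linarith), mul_one]
          _ < 1 := by nlinarith)
    have hder : ∀ x ∈ ball (0 : E) 1,
        HasFDerivWithinAt φ (1 + t • fderiv ℝ g x) (ball 0 1) x := fun x hx =>
      ((hasFDerivAt_id x).add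
        ((hderiv x (ball_subset_closedBall hx)).const_smul t)).hasFDerivWithinAt
    have h := integral_image_eq_integral_abs_det_fderiv_smul μ measurableSet_ball hder himg.1
      (fun _ => (1 : ℝ))
    rw [himg.2, setIntegral_const, smul_eq_mul, mul_one] at h
    rw [h]
    refine setIntegral_congr_fun measurableSet_ball fun x hx => ?_
    have hpos : 0 < (1 + t • fderiv ℝ g x).det := by
      apply det_one_add_pos
      rw [norm_smul, Real.norm_of_nonneg ht.le]
      exact lt_of_le_of_lt
        (mul_le_mul_of_nonneg_left (hCK x (ball_subset_closedBall hx)) ht.le) htK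
    simp [abs_of_pos hpos]
  -- the determinant vanishes at `t = 1`
  have hdet0 : ∀ x ∈ ball (0 : E) 1, (1 + fderiv ℝ g x).det = 0 := by
    intro x hx
    by_contra hne
    have hrd : HasFDerivAt r (1 + fderiv ℝ g x) x := by
      have h1 := (hasFDerivAt_id x).add (hderiv x (ball_subset_closedBall hx))
      have h2 : (id + g : E → E) = r := by funext y; simp [hg]
      rw [h2] at h1
      exact h1
    -- As `‖r‖²` is locally constant, the range of `Dr` at `x` is orthogonal to `r x`. Were `Dr`
    -- surjective, `r x` would be orthogonal to itself.
    have hsq := hrd.norm_sq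
    have hconst : (fun y => ‖r y‖ ^ 2) =ᶠ[nhds x] fun _ => (1 : ℝ) := by
      filter_upwards [isOpen_ball.mem_nhds hx] with y hy
      rw [hn y (ball_subset_closedBall hy), one_pow]
    have hz := (hsq.congr_of_eventuallyEq hconst.symm).unique (hasFDerivAt_const (1 : ℝ) x)
    have hsurj : Function.Surjective (1 + fderiv ℝ g x : E →L[ℝ] E) :=
      ((Module.End.isUnit_iff _).mp ((LinearMap.isUnit_iff_isUnit_det _).mpr
        (isUnit_iff_ne_zero.mpr hne))).surjective
    obtain ⟨y, hy⟩ := hsurj (r x)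
    have h3 := congrArg (fun l : E →L[ℝ] ℝ => l y) hz
    have h4 : (inner ℝ (r x) (r x) : ℝ) = 0 := by
      have h5 : 2 * inner ℝ (r x) ((1 + fderiv ℝ g x) y) = 0 := by
        simpa [mul_add, inner_add_right] using h3
      rw [hy] at h5
      linarith
    rw [real_inner_self_eq_norm_sq, hn x (ball_subset_closedBall hx)] at h4
    norm_num at h4
  -- interpolate
  set v : ℕ → ℝ := fun i => 1 / ((K + 2) * (i + 1)) with hv
  have hvinj : Function.Injective v := by
    intro i j hij
    have hK2 : (0 : ℝ) < K + 2 := by positivity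
    simp only [hv] at hij
    field_simp at hij
    exact_mod_cast (by linarith : (i : ℝ) = j)
  obtain ⟨k, hk1, hk⟩ := exists_weights_det (E := E) v hvinj
  have hint : ∀ t : ℝ, IntegrableOn (fun x => (1 + t • fderiv ℝ g x).det) (ball 0 1) μ := by
    intro t
    refine IntegrableOn.mono_set (t := closedBall 0 1) ?_ ball_subset_closedBall
    refine ContinuousOn.integrableOn_compact (isCompact_closedBall 0 1) ?_
    exact ContinuousLinearMap.continuous_det.comp_continuousOn
      (continuousOn_const.add (hfderiv.const_smul t))
  have h0 : ∫ x in ball (0 : E) 1, (1 + fderiv ℝ g x).det ∂μ = 0 := by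
    rw [setIntegral_congr_fun measurableSet_ball (g := fun _ => (0 : ℝ)) hdet0]
    simp
  have h1 : ∫ x in ball (0 : E) 1, ∑ i ∈ Finset.range (Module.finrank ℝ E + 1),
      k i * (1 + v i • fderiv ℝ g x).det ∂μ = 0 := by
    rw [← h0]
    exact integral_congr_ae (Filter.Eventually.of_forall fun x => (hk _).symm)
  rw [integral_finsetSum _ fun i _ => (hint (v i)).const_mul (k i)] at h1
  have hterm : ∀ i, ∫ x in ball (0 : E) 1, k i * (1 + v i • fderiv ℝ g x).det ∂μ =
      k i * μ.real (ball 0 1) := by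
    intro i
    have hK0 : (0 : ℝ) ≤ K := K.coe_nonneg
    have hi0 : (0 : ℝ) ≤ i := Nat.cast_nonneg i
    -- This one bound yields both `v i < 1` and `v i * K < 1`, so every node is in the range where
    -- `hvol` applies.
    have hden : (K : ℝ) + 1 < (K + 2) * (i + 1) := by nlinarith
    rw [integral_const_mul, hvol (v i) (by positivity)
      (by rw [hv]; simp only; rw [div_lt_one (by positivity)]; linarith)
      (by rw [hv]; simp only; rw [div_mul_eq_mul_div, one_mul, div_lt_one (by positivity)]
          linarith)]
  simp only [hterm] at h1
  rw [← Finset.sum_mul, hk1, one_mul] at h1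
  have hpos : 0 < μ.real (ball (0 : E) 1) :=
    ENNReal.toReal_pos (measure_ball_pos μ 0 one_pos).ne' measure_ball_lt_top.ne
  exact hpos.ne' h1

end Retraction

/-! ### From the no-retraction theorem to Brouwer's theorem. -/

section FixedPoint

variable {E : Type*} [NormedAddCommGroup E] [InnerProductSpace ℝ E] [FiniteDimensional ℝ E]

/-- Without a fixed point, the ray from `f x` through `x` hits the sphere at `x + q x • p x`, where
`q x` is the larger root of the quadratic equation `‖x + q p‖² = 1` and `D` is its reduced
discriminant. The strict bound on `f` makes `⟨x, p x⟩` positive on the sphere, hence `D > 0` on the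
whole closed ball. The square root is therefore smooth, and the result is a forbidden retraction. -/
theorem exists_fixedPoint_of_contDiff {f : E → E} (hf : ContDiff ℝ 1 f) (hb : ∀ x, ‖f x‖ < 1) :
    ∃ x ∈ closedBall (0 : E) 1, f x = x := by
  by_contra hcon
  push Not at hcon
  set p : E → E := fun x => x - f x with hp
  set D : E → ℝ := fun x => inner ℝ x (p x) ^ 2 + ‖p x‖ ^ 2 * (1 - ‖x‖ ^ 2) with hD
  set q : E → ℝ := fun x => (-inner ℝ x (p x) + Real.sqrt (D x)) / ‖p x‖ ^ 2 with hq
  have hp0 : ∀ x ∈ closedBall (0 : E) 1, 0 < ‖p x‖ ^ 2 := by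
    intro x hx
    have : p x ≠ 0 := fun h => hcon x hx (sub_eq_zero.mp h).symm
    positivity
  have hip : ∀ x ∈ sphere (0 : E) 1, 0 < inner ℝ x (p x) := by
    intro x hx
    rw [mem_sphere_zero_iff_norm] at hx
    have h1 : inner ℝ x (f x) ≤ ‖x‖ * ‖f x‖ := real_inner_le_norm _ _
    rw [hp]
    simp only
    rw [inner_sub_right, real_inner_self_eq_norm_sq, hx]
    rw [hx] at h1
    linarith [hb x]
  have hD0 : ∀ x ∈ closedBall (0 : E) 1, 0 < D x := by
    intro x hx
    rcases (mem_closedBall_zero_iff.mp hx).lt_or_eq with h | h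
    · have h2 : 0 < 1 - ‖x‖ ^ 2 := by nlinarith [norm_nonneg x]
      have := mul_pos (hp0 x hx) h2
      simp only [hD]
      positivity
    · have := hip x (mem_sphere_zero_iff_norm.mpr h)
      simp only [hD, h]
      simp only [one_pow, sub_self, mul_zero, add_zero]
      positivity
  have hpd : ContDiff ℝ 1 p := contDiff_id.sub hf
  refine no_retraction (r := fun x => x + q x • p x) ?_ ?_ ?_
  · intro x hx
    have hDd : ContDiff ℝ 1 D :=
      ((contDiff_id.inner ℝ hpd).pow 2).add
        ((hpd.norm_sq ℝ).mul (contDiff_const.sub (contDiff_id.norm_sq ℝ)))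
    have hqd : ContDiffAt ℝ 1 q x :=
      (((contDiff_id.inner ℝ hpd).contDiffAt.neg).add
        (hDd.contDiffAt.sqrt (hD0 x hx).ne')).div (hpd.norm_sq ℝ).contDiffAt (hp0 x hx).ne'
    exact contDiffAt_id.add (hqd.smul hpd.contDiffAt)
  · intro x hx
    have h1 := mem_sphere_zero_iff_norm.mp hx
    have h2 : Real.sqrt (D x) = inner ℝ x (p x) := by
      simp only [hD, h1]
      simp [Real.sqrt_sq (hip x hx).le]
    simp only [hq, h2]
    simp
  · intro x hx
    have h1 : Real.sqrt (D x) ^ 2 = D x := Real.sq_sqrt (hD0 x hx).le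
    have h2 : q x * ‖p x‖ ^ 2 = -inner ℝ x (p x) + Real.sqrt (D x) :=
      div_mul_cancel₀ _ (hp0 x hx).ne'
    have h3 : ‖x + q x • p x‖ ^ 2 = 1 := by
      rw [norm_add_sq_real, inner_smul_right, norm_smul, mul_pow, Real.norm_eq_abs, sq_abs]
      have h4 : (q x * ‖p x‖ ^ 2 + inner ℝ x (p x)) ^ 2 = D x := by
        linear_combination (q x * ‖p x‖ ^ 2 + inner ℝ x (p x) + Real.sqrt (D x)) * h2 + h1
      simp only [hD] at h4
      have h5 := (hp0 x hx).ne'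
      apply mul_left_cancel₀ h5
      linear_combination h4
    exact (pow_eq_one_iff_of_nonneg (norm_nonneg _) two_ne_zero).mp h3

/-- A `C¹` approximation within `ε / 2`, shrunk by `1 + ε / 2` to have norm below one, has a fixed
point that `f` moves by less than `ε`. By compactness the displacement `‖f x - x‖` attains its
minimum on the ball, which must be zero. -/
theorem exists_fixedPoint_of_norm_le_one {f : E → E} (hf : Continuous f) (hb : ∀ x, ‖f x‖ ≤ 1) :
    ∃ x, f x = x := by
  have happrox : ∀ ε > 0, ∃ x ∈ closedBall (0 : E) 1, ‖f x - x‖ < ε := by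
    intro ε hε
    obtain ⟨h, hh, hhf, -⟩ := hf.exists_contDiff_approx 1 (ε := fun _ => ε / 2)
      continuous_const (fun _ => half_pos hε)
    have hb' : ∀ x, ‖h x‖ < 1 + ε / 2 := fun x => by
      have h1 := hhf x
      rw [dist_eq_norm] at h1
      have h2 := norm_add_le (h x - f x) (f x)
      rw [sub_add_cancel] at h2
      linarith [hb x]
    have hpos : 0 < 1 + ε / 2 := by positivity
    obtain ⟨x, hx, hfx⟩ := exists_fixedPoint_of_contDiff
      (f := fun x => (1 + ε / 2)⁻¹ • h x) (contDiff_const.smul hh) (fun x => by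
        rw [norm_smul, Real.norm_of_nonneg (by positivity), inv_mul_lt_iff₀ hpos, mul_one]
        exact hb' x)
    refine ⟨x, hx, ?_⟩
    have h1 : h x = (1 + ε / 2) • x := by
      conv_rhs => rw [← hfx]
      rw [smul_inv_smul₀ hpos.ne']
    have h2 := hhf x
    rw [dist_eq_norm, norm_sub_rev] at h2
    calc ‖f x - x‖ = ‖(f x - h x) + (ε / 2) • x‖ := by
          rw [h1]; congr 1; module
      _ ≤ ‖f x - h x‖ + ‖(ε / 2) • x‖ := norm_add_le _ _
      _ < ε / 2 + ε / 2 := by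
          refine add_lt_add_of_lt_of_le h2 ?_
          rw [norm_smul, Real.norm_of_nonneg (by positivity)]
          have := mem_closedBall_zero_iff.mp hx
          nlinarith
      _ = ε := add_halves ε
  obtain ⟨x, hx, hmin⟩ := (isCompact_closedBall (0 : E) 1).exists_isMinOn
    ⟨0, mem_closedBall_self zero_le_one⟩ (f := fun x => ‖f x - x‖)
    (by fun_prop : Continuous fun x => ‖f x - x‖).continuousOn
  refine ⟨x, ?_⟩
  by_contra hne
  obtain ⟨y, hy, hlt⟩ := happrox _ (norm_pos_iff.mpr (sub_ne_zero.mpr hne))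
  exact absurd (hmin hy) (not_le.mpr hlt)

end FixedPoint

/-- **Brouwer's fixed point theorem** for bounded continuous self-maps of a finite-dimensional
normed space. -/
theorem exists_fixedPoint {W : Type*} [NormedAddCommGroup W] [NormedSpace ℝ W]
    [FiniteDimensional ℝ W] {f : W → W} (hf : Continuous f) {C : ℝ} (hb : ∀ x, ‖f x‖ ≤ C) :
    ∃ x, f x = x := by
  let e : W ≃L[ℝ] EuclideanSpace ℝ (Fin (Module.finrank ℝ W)) := toEuclidean
  have hC : 0 ≤ C := (norm_nonneg _).trans (hb 0)
  -- `R` bounds the norm of `e ∘ f`, so conjugating by `e` and rescaling gives a map into the unit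
  -- ball. The `+ 1` keeps `R` positive when `C = 0`.
  set R : ℝ := ‖(e : W →L[ℝ] EuclideanSpace ℝ (Fin (Module.finrank ℝ W)))‖ * C + 1 with hR
  have hR0 : 0 < R := by positivity
  obtain ⟨y, hy⟩ := exists_fixedPoint_of_norm_le_one
    (f := fun y => R⁻¹ • e (f (e.symm (R • y)))) (by fun_prop) (fun y => by
      rw [norm_smul, Real.norm_of_nonneg (by positivity), inv_mul_le_iff₀ hR0, mul_one]
      have h1 := (e : W →L[ℝ] EuclideanSpace ℝ (Fin (Module.finrank ℝ W))).le_opNorm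
        (f (e.symm (R • y)))
      have h2 := mul_le_mul_of_nonneg_left (hb (e.symm (R • y)))
        (norm_nonneg (e : W →L[ℝ] EuclideanSpace ℝ (Fin (Module.finrank ℝ W))))
      exact h1.trans (h2.trans (by linarith)))
  refine ⟨e.symm (R • y), ?_⟩
  apply e.injective
  rw [e.apply_symm_apply]
  conv_rhs => rw [← hy]
  rw [smul_inv_smul₀ hR0.ne']

end Brouwer


/-! ### From the first order system back to the scalar problem. -/

namespace MultipointBVP

/-- Values of a continuous function on `{0, …, N-1} × [-r, r]` are bounded by `‖g‖_r`. -/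
lemma abs_le_gNorm {N : ℕ} {g : ℝ × ℝ → ℝ} (hg : Continuous g) {r : ℝ} (t : Fin N) {x : ℝ}
    (hx : x ∈ Set.Icc (-r) r) : |g (((t : ℕ) : ℝ), x)| ≤ gNorm N g r := by
  refine le_csSup ?_ ⟨t, x, hx, rfl⟩
  have hbd : ∀ t : Fin N, ∃ C, ∀ x ∈ Set.Icc (-r) r, ‖g (((t : ℕ) : ℝ), x)‖ ≤ C := fun t =>
    isCompact_Icc.exists_bound_of_continuousOn (by fun_prop)
  choose C hC using hbd
  refine ⟨∑ t, |C t|, ?_⟩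
  rintro s ⟨t, x, hx, rfl⟩
  calc |g (((t : ℕ) : ℝ), x)| ≤ |C t| := (hC t x hx).trans (le_abs_self _)
    _ ≤ ∑ t, |C t| :=
      Finset.single_le_sum (f := fun t => |C t|) (fun _ _ => abs_nonneg _) (Finset.mem_univ t)

namespace LinearBVP

variable {n N : ℕ} [NeZero n] (𝓑 : LinearBVP n N)

lemma A_apply_last (t : ℕ) (v : E n) :
    Matrix.toEuclideanLin (𝓑.A t) v (last n) = -∑ j : Fin n, 𝓑.a t j * v j := by
  simp [Matrix.toLpLin_apply, Matrix.mulVec, dotProduct, A, Finset.sum_neg_distrib]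

lemma A_apply_of_succ_lt (t : ℕ) (v : E n) {j : ℕ} (hj : j + 1 < n) :
    Matrix.toEuclideanLin (𝓑.A t) v ⟨j, by omega⟩ = v ⟨j + 1, hj⟩ := by
  have hne : (⟨j, by omega⟩ : Fin n) ≠ last n := by
    intro h
    have := congrArg Fin.val h
    simp only [last] at this
    omega
  simp only [Matrix.toLpLin_apply, Matrix.mulVec, dotProduct, A, Matrix.of_apply, if_neg hne]
  rw [Finset.sum_eq_single ⟨j + 1, hj⟩]
  · simp
  · intro k _ hk
    rw [if_neg, zero_mul]
    intro h
    exact hk (Fin.ext h)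
  · simp

/-- The forcing term `(0, …, 0, h(t))`. -/
noncomputable def forcing (h : Fin N → ℝ) : 𝓑.Z := fun t => EuclideanSpace.single (last n) (h t)

lemma norm_forcing_le {h : Fin N → ℝ} {C : ℝ} (hC : 0 ≤ C) (hh : ∀ t, |h t| ≤ C) :
    ‖𝓑.forcing h‖ ≤ C :=
  (pi_norm_le_iff_of_nonneg hC).mpr fun t => by simpa [forcing] using hh t

/-- A solution of the first order system yields a solution of the scalar problem. -/
lemma exists_isSolution_of_L_eq {g : ℝ × ℝ → ℝ} {m : Fin n} (x : 𝓑.X)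
    (hx : 𝓑.L x = 𝓑.forcing fun t => g (((t : ℕ) : ℝ), x.1 t.castSucc m)) :
    ∃ y : ℕ → ℝ, 𝓑.IsSolution g m y := by
  -- Coordinates of `x`, extended by zero to indices in `ℕ`; the default is never used where `y`
  -- matters.
  set z : ℕ → ℕ → ℝ := fun t j => if h : t < N + 1 ∧ j < n then x.1 ⟨t, h.1⟩ ⟨j, h.2⟩ else 0
    with hz
  have hzx : ∀ (t : Fin (N + 1)) (j : Fin n), z t j = x.1 t j := fun t j => by
    simp only [hz]; rw [dif_pos ⟨t.2, j.2⟩]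
  have hstep : ∀ t : Fin N, x.1 t.succ = Matrix.toEuclideanLin (𝓑.A t) (x.1 t.castSucc) +
      EuclideanSpace.single (last n) (g (((t : ℕ) : ℝ), x.1 t.castSucc m)) := fun t =>
    sub_eq_iff_eq_add'.mp (congrFun hx t)
  -- The superdiagonal rows of the companion system make `z t j` depend on `t + j` alone.
  have hshift : ∀ t < N, ∀ j, j + 1 < n → z t (j + 1) = z (t + 1) j := by
    intro t ht j hj
    have h := congrArg (fun v : E n => v ⟨j, by omega⟩) (hstep ⟨t, ht⟩)
    have hne : (⟨j, by omega⟩ : Fin n) ≠ last n := by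
      intro h
      have := congrArg Fin.val h
      simp only [last] at this
      omega
    simp only [PiLp.add_apply, 𝓑.A_apply_of_succ_lt t _ hj, PiLp.single_apply,
      if_neg hne, add_zero] at h
    rw [show z t (j + 1) = _ from hzx (Fin.castSucc ⟨t, ht⟩) ⟨j + 1, hj⟩,
      show z (t + 1) j = _ from hzx (Fin.succ ⟨t, ht⟩) ⟨j, by omega⟩]
    exact h.symm
  -- For `k ≤ N` this is the first coordinate at time `k`; later values come from the coordinates of
  -- the final vector `x(N)`.
  set y : ℕ → ℝ := fun k => z (min k N) (k - min k N) with hy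
  have hyz : ∀ t ≤ N, ∀ j < n, z t j = y (t + j) := by
    intro t ht
    -- At `t = N` the claim is the definition of `y`, and `hshift` carries it from `t + 1` down to
    -- `t`.
    induction ht using Nat.decreasingInduction with
    | self =>
      intro j hj
      simp [hy]
    | of_succ t ht ih =>
      intro j hj
      rcases j with _ | j
      · simp [hy, min_eq_left (Nat.le_of_lt ht)]
      · rw [hshift t ht j hj, ih j (by omega)]
        congr 1
        omega
  refine ⟨y, fun t ht => ?_, fun i => ?_⟩
  · have hn : 0 < n := Nat.pos_of_ne_zero (NeZero.ne n)
    have hlast := congrArg (fun v : E n => v (last n)) (hstep ⟨t, ht⟩)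
    simp only [PiLp.add_apply, A_apply_last, PiLp.single_apply, if_true] at hlast
    have hv : ∀ j : Fin n, x.1 (Fin.castSucc ⟨t, ht⟩) j = y (t + j) := fun j => by
      rw [← hzx]; exact hyz t ht.le j j.2
    have hv' : x.1 (Fin.succ ⟨t, ht⟩) (last n) = y (t + n) := by
      rw [← hzx]
      refine (hyz (t + 1) ht (n - 1) (by omega)).trans ?_
      congr 1
      omega
    simp only [hv, hv'] at hlast
    rw [hlast]
    ring
  · have hb := congrArg (fun v : E n => v i) (𝓑.mem_X.mp x.2)
    rw [← Fin.sum_univ_eq_sum_range (fun k => ∑ j : Fin n, 𝓑.b k i j * y ((j : ℕ) + k)) (N + 1)]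
    simp only [WithLp.ofLp_sum, Finset.sum_apply, PiLp.zero_apply, Matrix.toLpLin_apply,
      Matrix.mulVec, dotProduct] at hb
    rw [← hb]
    refine Finset.sum_congr rfl fun k _ => Finset.sum_congr rfl fun j _ => ?_
    rw [← hzx k j, hyz k (by omega) j j.2, add_comm (k : ℕ)]

/-! ### The Lyapunov–Schmidt splitting. -/

lemma L_MpIQ {w : E n} (hw : IsBasisVector w 𝓑.kerMT) (h : 𝓑.Z) :
    𝓑.L (𝓑.MpIQ hw h) = h - 𝓑.Q w h :=
  congrArg Subtype.val ((LinearEquiv.ofBijective 𝓑.LKerP 𝓑.LKerP_bijective).apply_symm_apply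
    (LinearMap.codRestrict (LinearMap.range 𝓑.L) (LinearMap.id - 𝓑.Q w)
      (𝓑.sub_Q_mem_range hw) h))

lemma norm_MpIQ_le {w : E n} (hw : IsBasisVector w 𝓑.kerMT) (h : 𝓑.Z) :
    ‖𝓑.MpIQ hw h‖ ≤ 𝓑.opNormA hw * ‖h‖ :=
  (LinearMap.toContinuousLinearMap (𝓑.MpIQ hw)).le_opNorm h

/-- The forcing has only a last coordinate, so its pairing with `Ψ` sees only `ψ`: the vanishing of
`Q` becomes one scalar equation. -/
lemma Q_forcing_eq_zero {w : E n} {h : Fin N → ℝ} (hh : ∑ t, 𝓑.ψ w t * h t = 0) :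
    𝓑.Q w (𝓑.forcing h) = 0 := by
  funext t
  rw [Q_apply]
  have : ∑ i : Fin N, inner ℝ (𝓑.Ψ w (i : ℕ)) (𝓑.forcing h i) = 0 := by
    rw [← hh]
    refine Finset.sum_congr rfl fun i _ => ?_
    simp [forcing, ψ, EuclideanSpace.inner_single_right, mul_comm]
  rw [this, zero_smul, Pi.zero_apply]

/-- The element `S` of `Ker 𝓛` generated by `u`. -/
noncomputable def kerElem {u : E n} (hu : IsBasisVector u 𝓑.kerM) : 𝓑.X :=
  ⟨fun t => 𝓑.S u t, by
    have h : u ∈ 𝓑.kerM := hu.2 ▸ Submodule.mem_span_singleton_self u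
    rw [kerM, LinearMap.mem_ker, M_apply] at h
    rw [mem_X]
    exact h⟩

lemma L_kerElem {u : E n} (hu : IsBasisVector u 𝓑.kerM) : 𝓑.L (𝓑.kerElem hu) = 0 := by
  funext t
  rw [L_apply]
  simp [kerElem, S, Φ, Matrix.toLpLin_mul_same]

/-! ### Sign estimates over `𝓞` and the reduced problem. -/

variable (u w : E n) (m : Fin n)

lemma abs_σ_le_sMax (t : Fin N) : |𝓑.σ u m t| ≤ 𝓑.sMax u m :=
  le_ciSup (f := fun t : Fin N => |𝓑.σ u m t|) (Set.finite_range _).bddAbove t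

variable {u w m}

lemma sMin_le {t : Fin N} (ht : t ∈ 𝓑.O u w m) : 𝓑.sMin u w m ≤ |𝓑.σ u m t| :=
  ciInf_le (f := fun t : 𝓑.O u w m => |𝓑.σ u m t|) (Set.finite_range _).bddBelow ⟨t, ht⟩

lemma mem_O_iff {t : Fin N} : t ∈ 𝓑.O u w m ↔ 𝓑.ψ w t ≠ 0 ∧ 𝓑.σ u m t ≠ 0 := by
  simp only [O, Opp, Opm, Omp, Omm, Set.mem_union, Set.mem_ofPred_eq, ne_iff_lt_or_gt]
  tauto

lemma sMin_pos (hO : (𝓑.O u w m).Nonempty) : 0 < 𝓑.sMin u w m := by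
  have := hO.to_subtype
  obtain ⟨t, ht⟩ := exists_eq_ciInf_of_finite (f := fun t : 𝓑.O u w m => |𝓑.σ u m t|)
  rw [sMin, ← ht]
  exact abs_pos.mpr (𝓑.mem_O_iff.mp t.2).2

lemma glue_neg (f₁ f₂ f₃ f₄ : Fin N → ℝ) (t : Fin N) :
    𝓑.glue u w m (-f₁) (-f₂) (-f₃) (-f₄) t = -𝓑.glue u w m f₁ f₂ f₃ f₄ t := by
  simp only [glue]
  split_ifs <;> simp

/-- The comparison is termwise. The inequalities are reversed where `ψ < 0`, so multiplying by `ψ`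
aligns all four cases. Off `𝓞`, C1 forces `ψ = 0` and the terms agree; strictness comes from a point
of `𝓞`. -/
lemma sum_glue_lt (hO : (𝓑.O u w m).Nonempty) (hC1 : 𝓑.Ozero u w m = ∅)
    {f₁ f₂ f₃ f₄ h : Fin N → ℝ} (h₁ : ∀ t ∈ 𝓑.Opp u w m, f₁ t < h t)
    (h₂ : ∀ t ∈ 𝓑.Opm u w m, f₂ t < h t) (h₃ : ∀ t ∈ 𝓑.Omp u w m, h t < f₃ t)
    (h₄ : ∀ t ∈ 𝓑.Omm u w m, h t < f₄ t) :
    ∑ t, 𝓑.ψ w t * 𝓑.glue u w m f₁ f₂ f₃ f₄ t < ∑ t, 𝓑.ψ w t * h t := by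
  have key : ∀ t ∈ 𝓑.O u w m, 𝓑.ψ w t * 𝓑.glue u w m f₁ f₂ f₃ f₄ t < 𝓑.ψ w t * h t := by
    intro t ht
    simp only [glue]
    split_ifs with a b c e
    · exact mul_lt_mul_of_pos_left (h₁ t a) a.1
    · exact mul_lt_mul_of_pos_left (h₂ t b) b.1
    · exact mul_lt_mul_of_neg_left (h₃ t c) c.1
    · exact mul_lt_mul_of_neg_left (h₄ t e) e.1
    · simp only [O, Set.mem_union] at ht
      tauto
  obtain ⟨t₀, ht₀⟩ := hO
  refine Finset.sum_lt_sum (fun t _ => ?_) ⟨t₀, Finset.mem_univ _, key t₀ ht₀⟩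
  by_cases ht : t ∈ 𝓑.O u w m
  · exact (key t ht).le
  · have hψ : 𝓑.ψ w t = 0 := by
      by_contra hψ
      have hσ : 𝓑.σ u m t = 0 := by
        by_contra hσ
        exact ht (𝓑.mem_O_iff.mpr ⟨hψ, hσ⟩)
      have : t ∈ 𝓑.Ozero u w m := ⟨hψ, hσ⟩
      rw [hC1] at this
      exact this
    simp [hψ]

lemma lt_sum_glue (hO : (𝓑.O u w m).Nonempty) (hC1 : 𝓑.Ozero u w m = ∅)
    {f₁ f₂ f₃ f₄ h : Fin N → ℝ} (h₁ : ∀ t ∈ 𝓑.Opp u w m, h t < f₁ t)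
    (h₂ : ∀ t ∈ 𝓑.Opm u w m, h t < f₂ t) (h₃ : ∀ t ∈ 𝓑.Omp u w m, f₃ t < h t)
    (h₄ : ∀ t ∈ 𝓑.Omm u w m, f₄ t < h t) :
    ∑ t, 𝓑.ψ w t * h t < ∑ t, 𝓑.ψ w t * 𝓑.glue u w m f₁ f₂ f₃ f₄ t := by
  have := 𝓑.sum_glue_lt hO hC1 (f₁ := -f₁) (f₂ := -f₂) (f₃ := -f₃) (f₄ := -f₄) (h := -h)
    (fun t ht => neg_lt_neg (h₁ t ht)) (fun t ht => neg_lt_neg (h₂ t ht))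
    (fun t ht => neg_lt_neg (h₃ t ht)) (fun t ht => neg_lt_neg (h₄ t ht))
  simp only [glue_neg, Pi.neg_apply, mul_neg, Finset.sum_neg_distrib] at this
  exact neg_lt_neg_iff.mp this

/-- Lyapunov–Schmidt reduction with Brouwer's theorem: if the bounded nonlinearity `h` has, on the
two faces `α = ±β`, a bifurcation function of opposite signs, then `𝓛x = h(x)` has a solution
`x = αS + v` with `|α| ≤ β`. -/
lemma exists_L_eq_forcing (hu : IsBasisVector u 𝓑.kerM) (hw : IsBasisVector w 𝓑.kerMT)
    {h : Fin N → ℝ → ℝ} (hh : ∀ t, Continuous (h t)) {G β : ℝ} (hG : 0 ≤ G) (hβ : 0 < β)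
    (hhG : ∀ t x, |h t x| ≤ G)
    (hpos : ∀ e : Fin N → ℝ, (∀ t, |e t| ≤ 𝓑.opNormA hw * G) →
      0 < ∑ t, 𝓑.ψ w t * h t (β * 𝓑.σ u m t + e t))
    (hneg : ∀ e : Fin N → ℝ, (∀ t, |e t| ≤ 𝓑.opNormA hw * G) →
      ∑ t, 𝓑.ψ w t * h t (-β * 𝓑.σ u m t + e t) < 0) :
    ∃ (x : 𝓑.X) (α : ℝ), |α| ≤ β ∧
      (∀ t : Fin N, |x.1 t.castSucc m - α * 𝓑.σ u m t| ≤ 𝓑.opNormA hw * G) ∧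
      𝓑.L x = 𝓑.forcing fun t => h t (x.1 t.castSucc m) := by
  have hA : 0 ≤ 𝓑.opNormA hw :=
    norm_nonneg (LinearMap.toContinuousLinearMap (𝓑.MpIQ hw))
  let H : ℝ × 𝓑.X → Fin N → ℝ := fun p t => h t (p.1 * 𝓑.σ u m t + p.2.1 t.castSucc m)
  have hH : Continuous H := by
    refine continuous_pi fun t => (hh t).comp ?_
    have h1 : Continuous fun p : ℝ × 𝓑.X => p.2.1 t.castSucc :=
      (continuous_apply t.castSucc).comp (continuous_subtype_val.comp continuous_snd)
    fun_prop
  have hF : Continuous fun p => 𝓑.forcing (H p) := by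
    refine continuous_pi fun t => ?_
    have h1 : Continuous fun p => H p t := (continuous_apply t).comp hH
    exact ((PiLp.continuous_toLp 2 _).comp (continuous_single (A := fun _ => ℝ) (last n))).comp h1
  have hv : ∀ p, ‖𝓑.MpIQ hw (𝓑.forcing (H p))‖ ≤ 𝓑.opNormA hw * G := fun p =>
    (𝓑.norm_MpIQ_le hw _).trans
      (mul_le_mul_of_nonneg_left (𝓑.norm_forcing_le hG fun t => hhG t _) hA)
  -- A fixed point solves the equation for `v`, and also the scalar equation wherever the clamp on
  -- `α` is inactive. The clamp keeps `T` bounded.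
  let T : ℝ × 𝓑.X → ℝ × 𝓑.X := fun p =>
    (max (-β) (min β (p.1 - ∑ t, 𝓑.ψ w t * H p t)), 𝓑.MpIQ hw (𝓑.forcing (H p)))
  have hT : Continuous T := by
    refine Continuous.prodMk ?_ ?_
    · have h1 : ∀ t, Continuous fun p => H p t := fun t => (continuous_apply t).comp hH
      fun_prop
    · exact (LinearMap.toContinuousLinearMap (𝓑.MpIQ hw)).continuous.comp hF
  have hclamp : ∀ a : ℝ, |max (-β) (min β a)| ≤ β := fun a =>
    abs_le.mpr ⟨le_max_left _ _, max_le (by linarith) (min_le_left _ _)⟩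
  obtain ⟨⟨α, v⟩, hfix⟩ := Brouwer.exists_fixedPoint hT (C := max β (𝓑.opNormA hw * G))
    fun p => max_le_max (hclamp _) (hv p)
  have hα : max (-β) (min β (α - ∑ t, 𝓑.ψ w t * H (α, v) t)) = α := congrArg Prod.fst hfix
  have hveq : 𝓑.MpIQ hw (𝓑.forcing (H (α, v))) = v := congrArg Prod.snd hfix
  have hvb : ∀ t : Fin N, |v.1 t.castSucc m| ≤ 𝓑.opNormA hw * G := fun t =>
    calc |v.1 t.castSucc m| ≤ ‖v.1 t.castSucc‖ := PiLp.norm_apply_le (v.1 t.castSucc) m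
      _ ≤ ‖v‖ := norm_le_pi_norm v.1 t.castSucc
      _ ≤ _ := hveq ▸ hv (α, v)
  have hαβ : |α| ≤ β := hα ▸ hclamp _
  -- On the face `α = -β` the sum is negative, so subtracting it would push `α` inward and the point
  -- would not be fixed; likewise at `α = β`. In the interior the clamp is inactive and the sum is
  -- zero.
  have hJ : ∑ t, 𝓑.ψ w t * H (α, v) t = 0 := by
    rcases (abs_le.mp hαβ).1.eq_or_lt with h1 | h1
    · have := hneg (fun t => v.1 t.castSucc m) hvb
      rw [h1] at this
      change ∑ t, 𝓑.ψ w t * H (α, v) t < 0 at this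
      have h2 : α < min β (α - ∑ t, 𝓑.ψ w t * H (α, v) t) := lt_min (by linarith) (by linarith)
      have h3 := le_max_right (-β) (min β (α - ∑ t, 𝓑.ψ w t * H (α, v) t))
      linarith
    · rcases (abs_le.mp hαβ).2.eq_or_lt with h2 | h2
      · have := hpos (fun t => v.1 t.castSucc m) hvb
        rw [← h2] at this
        change 0 < ∑ t, 𝓑.ψ w t * H (α, v) t at this
        have h3 : max (-β) (min β (α - ∑ t, 𝓑.ψ w t * H (α, v) t)) < α :=
          max_lt h1 ((min_le_right _ _).trans_lt (by linarith))
        linarith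
      · rcases max_choice (-β) (min β (α - ∑ t, 𝓑.ψ w t * H (α, v) t)) with h3 | h3
        · linarith
        · rcases min_choice β (α - ∑ t, 𝓑.ψ w t * H (α, v) t) with h4 | h4 <;> linarith
  have hx : ∀ t : Fin N, (α • 𝓑.kerElem hu + v).1 t.castSucc m =
      α * 𝓑.σ u m t + v.1 t.castSucc m := fun t => rfl
  refine ⟨α • 𝓑.kerElem hu + v, α, hαβ, fun t => ?_, ?_⟩
  · rw [hx, add_sub_cancel_left]
    exact hvb t
  · rw [map_add, map_smul, L_kerElem, smul_zero, zero_add, ← hveq, L_MpIQ,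
      𝓑.Q_forcing_eq_zero hJ, sub_zero, hveq]
    rfl

end LinearBVP

end MultipointBVP

/-! ### The existence theorem for the boundary value problem. -/

theorem theorem3p1 {n N : ℕ} [NeZero n] (hN : 2 < N)
    (𝓑 : MultipointBVP.LinearBVP n N)
    -- resonance with a one-dimensional solution space of the linear homogeneous problem
    (hres : Module.finrank ℝ (LinearMap.ker 𝓑.L) = 1)
    (g : ℝ × ℝ → ℝ) (hg : Continuous g)
    -- the index `m`, counted from `0`
    (m : Fin n)
    (u w : MultipointBVP.E n)
    (hu : MultipointBVP.IsBasisVector u 𝓑.kerM)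
    (hw : MultipointBVP.IsBasisVector w 𝓑.kerMT)
    -- the minimum `s_min` over `𝓞` is taken over a nonempty set
    (hO : (𝓑.O u w m).Nonempty)
    -- C1
    (hC1 : 𝓑.Ozero u w m = ∅)
    -- C2
    (c d : ℝ) (hc : 0 < c) (hcd : c < d)
    (W₁ U₁ W₂ U₂ w₁ u₁ w₂ u₂ : Fin N → ℝ)
    (hpp_pos : ∀ t ∈ 𝓑.Opp u w m, ∀ x ∈ Set.Icc c d, W₁ t < g (((t : ℕ) : ℝ), x))
    (hpp_neg : ∀ t ∈ 𝓑.Opp u w m, ∀ x ∈ Set.Icc (-d) (-c), g (((t : ℕ) : ℝ), x) < U₁ t)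
    (hpm_pos : ∀ t ∈ 𝓑.Opm u w m, ∀ x ∈ Set.Icc c d, g (((t : ℕ) : ℝ), x) < u₁ t)
    (hpm_neg : ∀ t ∈ 𝓑.Opm u w m, ∀ x ∈ Set.Icc (-d) (-c), w₁ t < g (((t : ℕ) : ℝ), x))
    (hmp_pos : ∀ t ∈ 𝓑.Omp u w m, ∀ x ∈ Set.Icc c d, g (((t : ℕ) : ℝ), x) < W₂ t)
    (hmp_neg : ∀ t ∈ 𝓑.Omp u w m, ∀ x ∈ Set.Icc (-d) (-c), U₂ t < g (((t : ℕ) : ℝ), x))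
    (hmm_pos : ∀ t ∈ 𝓑.Omm u w m, ∀ x ∈ Set.Icc c d, u₂ t < g (((t : ℕ) : ℝ), x))
    (hmm_neg : ∀ t ∈ 𝓑.Omm u w m, ∀ x ∈ Set.Icc (-d) (-c), g (((t : ℕ) : ℝ), x) < w₂ t)
    -- C3
    (hC3 : (c * 𝓑.sMax u m + 𝓑.opNormA hw * MultipointBVP.gNorm N g d *
        (𝓑.sMax u m + 𝓑.sMin u w m)) / 𝓑.sMin u w m < d)
    -- C4
    (hJ₂ : ∑ t : Fin N, 𝓑.ψ w t * 𝓑.glue u w m U₁ u₁ U₂ u₂ t ≤ 0)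
    (hJ₁ : 0 ≤ ∑ t : Fin N, 𝓑.ψ w t * 𝓑.glue u w m W₁ w₁ W₂ w₂ t) :
    ∃ y : ℕ → ℝ, 𝓑.IsSolution g m y := by
  set A := 𝓑.opNormA hw with hA
  set G := MultipointBVP.gNorm N g d with hG
  set s := 𝓑.sMin u w m with hs
  have hs0 : 0 < s := 𝓑.sMin_pos hO
  have hA0 : 0 ≤ A := norm_nonneg (LinearMap.toContinuousLinearMap (𝓑.MpIQ hw))
  have hd0 : 0 < d := hc.trans hcd
  have hgG : ∀ (t : Fin N) (x : ℝ), x ∈ Set.Icc (-d) d → |g (((t : ℕ) : ℝ), x)| ≤ G :=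
    fun t x hx => MultipointBVP.abs_le_gNorm hg t hx
  have hG0 : 0 ≤ G :=
    (abs_nonneg _).trans (hgG ⟨0, by omega⟩ 0 ⟨by linarith, hd0.le⟩)
  -- Chosen so that `β * s - A * G = c`: on `𝓞` the kernel part then exceeds the largest possible
  -- error by at least `c`.
  set β := (c + A * G) / s with hβ
  have hβ0 : 0 < β := by positivity
  -- The left-hand side is exactly the quotient in C3.
  have hβd : β * 𝓑.sMax u m + A * G < d := by
    refine lt_of_eq_of_lt ?_ hC3
    rw [hβ]
    field_simp
    ring
  have hupper : ∀ t : Fin N, β * |𝓑.σ u m t| + A * G ≤ d := fun t => by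
    have := mul_le_mul_of_nonneg_left (𝓑.abs_σ_le_sMax u m t) hβ0.le
    linarith
  have hlower : ∀ t ∈ 𝓑.O u w m, c + A * G ≤ β * |𝓑.σ u m t| := fun t ht => by
    have := mul_le_mul_of_nonneg_left (𝓑.sMin_le ht) hβ0.le
    rwa [hβ, div_mul_cancel₀ _ hs0.ne'] at this
  have hright : ∀ t ∈ 𝓑.O u w m, ∀ a e : ℝ, a = β * |𝓑.σ u m t| → |e| ≤ A * G →
      a + e ∈ Set.Icc c d := by
    rintro t ht a e rfl he
    have := abs_le.mp he
    exact ⟨by linarith [hlower t ht], by linarith [hupper t]⟩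
  have hleft : ∀ t ∈ 𝓑.O u w m, ∀ a e : ℝ, a = -(β * |𝓑.σ u m t|) → |e| ≤ A * G →
      a + e ∈ Set.Icc (-d) (-c) := by
    rintro t ht a e rfl he
    have := abs_le.mp he
    exact ⟨by linarith [hupper t], by linarith [hlower t ht]⟩
  have hclamp : ∀ x ∈ Set.Icc (-d) d, max (-d) (min d x) = x := fun x hx => by
    rw [min_eq_right hx.2, max_eq_right hx.1]
  have hclamp_right : ∀ x ∈ Set.Icc c d, max (-d) (min d x) ∈ Set.Icc c d := fun x hx => by
    rwa [hclamp x ⟨by linarith [hx.1], hx.2⟩]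
  have hclamp_left : ∀ x ∈ Set.Icc (-d) (-c), max (-d) (min d x) ∈ Set.Icc (-d) (-c) :=
    fun x hx => by rwa [hclamp x ⟨hx.1, by linarith [hx.2]⟩]
  have hO_pp : ∀ t ∈ 𝓑.Opp u w m, t ∈ 𝓑.O u w m := fun t ht => Or.inl (Or.inl (Or.inl ht))
  have hO_pm : ∀ t ∈ 𝓑.Opm u w m, t ∈ 𝓑.O u w m := fun t ht => Or.inl (Or.inl (Or.inr ht))
  have hO_mp : ∀ t ∈ 𝓑.Omp u w m, t ∈ 𝓑.O u w m := fun t ht => Or.inl (Or.inr ht)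
  have hO_mm : ∀ t ∈ 𝓑.Omm u w m, t ∈ 𝓑.O u w m := fun t ht => Or.inr ht
  -- The truncated nonlinearity is bounded by `G` everywhere. On each of the four sets, the sign of
  -- `σ` decides whether the face `α = β` or `α = -β` places the argument in `[c, d]` or `[-d, -c]`,
  -- and hence which half of C2 applies.
  obtain ⟨x, α, hα, hxα, hx⟩ := 𝓑.exists_L_eq_forcing hu hw
    (h := fun t x => g (((t : ℕ) : ℝ), max (-d) (min d x))) (fun t => by fun_prop) hG0 hβ0
    (fun t x => hgG t _ ⟨le_max_left _ _, max_le (by linarith) (min_le_left _ _)⟩)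
    (fun e he => hJ₁.trans_lt (𝓑.sum_glue_lt hO hC1
      (fun t ht => hpp_pos t ht _ (hclamp_right _ (hright t (hO_pp t ht) _ _
        (by rw [abs_of_pos ht.2]) (he t))))
      (fun t ht => hpm_neg t ht _ (hclamp_left _ (hleft t (hO_pm t ht) _ _
        (by rw [abs_of_neg ht.2]; ring) (he t))))
      (fun t ht => hmp_pos t ht _ (hclamp_right _ (hright t (hO_mp t ht) _ _
        (by rw [abs_of_pos ht.2]) (he t))))
      (fun t ht => hmm_neg t ht _ (hclamp_left _ (hleft t (hO_mm t ht) _ _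
        (by rw [abs_of_neg ht.2]; ring) (he t))))))
    (fun e he => (𝓑.lt_sum_glue hO hC1
      (fun t ht => hpp_neg t ht _ (hclamp_left _ (hleft t (hO_pp t ht) _ _
        (by rw [abs_of_pos ht.2]; ring) (he t))))
      (fun t ht => hpm_pos t ht _ (hclamp_right _ (hright t (hO_pm t ht) _ _
        (by rw [abs_of_neg ht.2]; ring) (he t))))
      (fun t ht => hmp_neg t ht _ (hclamp_left _ (hleft t (hO_mp t ht) _ _
        (by rw [abs_of_pos ht.2]; ring) (he t))))
      (fun t ht => hmm_pos t ht _ (hclamp_right _ (hright t (hO_mm t ht) _ _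
        (by rw [abs_of_neg ht.2]; ring) (he t))))).trans_le hJ₂)
  refine 𝓑.exists_isSolution_of_L_eq x (hx.trans (congrArg 𝓑.forcing (funext fun t => ?_)))
  -- The solution stays in `[-d, d]`, so there the truncated nonlinearity coincides with `g`.
  have hb : |x.1 t.castSucc m| ≤ d := by
    have h1 := abs_sub_abs_le_abs_sub (x.1 t.castSucc m) (α * 𝓑.σ u m t)
    have h2 : |α * 𝓑.σ u m t| ≤ β * |𝓑.σ u m t| := by
      rw [abs_mul]
      exact mul_le_mul_of_nonneg_right hα (abs_nonneg _)
    linarith [hxα t, hupper t]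
  simp only [hclamp _ (abs_le.mp hb)]
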